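/- Let $m\ge n\ge 0$ be integers and let $M=(a_{ij})$ be an $m\times n$ integer matrix of full rank. Let $Y(M)$ be the real analytic manifold underlying the smooth affine variety $$X(M)=\Big\{(x,y,z)\in\mathbb C^{n}\times\mathbb C^{n}\times(\mathbb C^*)^m \;:\; x_jy_j=\prod_{i=1}^m z_i^{a_{ij}}+1,\ 1\le j\le n\Big\},$$ and let $h:Y(M)\to\mathbb R^{n+m}$ be the map $$h(x,y,z)=\big(|x_1|^2-|y_1|^2,\dots,|x_n|^2-|y_n|^2,\ \log|z_1|,\dots,\log|z_m|\big).$$ Then the general fibers of $h$ are tori $T^{n+m}$. Precisely: the set of regular values of $h$ is open and dense in $\mathbb R^{n+m}$, and for every regular value $c$ the fiber $h^{-1}(c)$ is an embedded smooth submanifold diffeomorphic to $T^{n+m}=(S^1)^{n+m}$. -/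

import Mathlib

open scoped Manifold ContDiff

namespace IsolatedCluster

/-- The affine space `ℂⁿ × ℂⁿ × ℂᵐ`, with points `p = (x, y, z)`. -/
abbrev Ambient (m n : ℕ) : Type := (Fin n → ℂ) × (Fin n → ℂ) × (Fin m → ℂ)

/-- The base `ℝⁿ × ℝᵐ = ℝⁿ⁺ᵐ` of the fibration. -/
abbrev Base (m n : ℕ) : Type := (Fin n → ℝ) × (Fin m → ℝ)

/-- The left minus the right sides of the equations `x_j y_j = ∏ᵢ z_i ^ a_{ij} + 1`, where
`M = (a_{ij})`. -/
noncomputable def equations {m n : ℕ} (M : Matrix (Fin m) (Fin n) ℤ) (p : Ambient m n) :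
    Fin n → ℂ :=
  fun j => p.1 j * p.2.1 j - ((∏ i, p.2.2 i ^ M i j) + 1)

/-- The total space `Y(M)`: the points of `ℂ²ⁿ × (ℂˣ)ᵐ` that satisfy
`x_j y_j = ∏ᵢ z_i ^ a_{ij} + 1` for all `j`. -/
def totalSpace {m n : ℕ} (M : Matrix (Fin m) (Fin n) ℤ) : Set (Ambient m n) :=
  {p | (∀ i, p.2.2 i ≠ 0) ∧ equations M p = 0}

/-- The map `h(x, y, z) = (|x_j|² - |y_j|², log |z_k|)`. Only its values on the open set where
all `z_k` are nonzero are used; there it is smooth. -/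
noncomputable def fibration (m n : ℕ) (p : Ambient m n) : Base m n :=
  (fun j => ‖p.1 j‖ ^ 2 - ‖p.2.1 j‖ ^ 2, fun k => Real.log ‖p.2.2 k‖)

/-- The fiber of `h : Y(M) → ℝⁿ⁺ᵐ` over `c`, as a subset of the affine space. -/
def fiber {m n : ℕ} (M : Matrix (Fin m) (Fin n) ℤ) (c : Base m n) : Set (Ambient m n) :=
  {p | p ∈ totalSpace M ∧ fibration m n p = c}

/-- The real tangent space of `Y(M)` at a point `p`, as a subspace of the affine space: the
kernel of the differential of the defining equations. For `M` of full column rank the equations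
cut out `Y(M)` transversally, see `equations_submersion`. -/
noncomputable def tangentSpaceAt {m n : ℕ} (M : Matrix (Fin m) (Fin n) ℤ) (p : Ambient m n) :
    Submodule ℝ (Ambient m n) :=
  LinearMap.ker (fderiv ℝ (equations M) p : Ambient m n →ₗ[ℝ] (Fin n → ℂ))

/-- `c` is a regular value of `h : Y(M) → ℝⁿ⁺ᵐ`: at each point of the fiber over `c`, the
differential of `h` maps the tangent space of `Y(M)` onto `ℝⁿ⁺ᵐ`. -/
def IsRegularValue {m n : ℕ} (M : Matrix (Fin m) (Fin n) ℤ) (c : Base m n) : Prop :=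
  ∀ p ∈ fiber M c, ∀ w : Base m n, ∃ v ∈ tangentSpaceAt M p, fderiv ℝ (fibration m n) p v = w

/-- The torus `T^N = (S¹)^N`, a product of `N` copies of Mathlib's circle, with the product
manifold structure. -/
abbrev Torus (N : ℕ) : Type := Fin N → Circle

/-- The model with corners of the product manifold `T^N`. -/
noncomputable abbrev torusModel (N : ℕ) :
    ModelWithCorners ℝ (Fin N → EuclideanSpace ℝ (Fin 1))
      (ModelPi fun _ : Fin N => EuclideanSpace ℝ (Fin 1)) :=
  ModelWithCorners.pi fun _ => 𝓡 1

/-- A subset `S` of a normed space is an embedded smooth submanifold diffeomorphic to `T^N`: it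
is the image of a smooth embedding of `T^N`, that is, of a smooth map that has injective
differentials and is a homeomorphism onto its image. -/
def IsEmbeddedTorus {V : Type*} [NormedAddCommGroup V] [NormedSpace ℝ V] (N : ℕ) (S : Set V) :
    Prop :=
  ∃ φ : Torus N → V,
    ContMDiff (torusModel N) 𝓘(ℝ, V) ∞ φ ∧
    (∀ t, Function.Injective (mfderiv (torusModel N) 𝓘(ℝ, V) φ t)) ∧
    Topology.IsEmbedding φ ∧
    Set.range φ = S

/-- For `M` of full column rank, the defining equations have surjective differential at every
point of `Y(M)` (indeed wherever all `z_i` are nonzero). -/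
theorem equations_submersion {m n : ℕ} (M : Matrix (Fin m) (Fin n) ℤ)
    (hM : (M.map (Int.cast : ℤ → ℚ)).rank = n) (p : Ambient m n) (hp : p ∈ totalSpace M) :
    Function.Surjective (fderiv ℝ (equations M) p) := by
  intro w
  obtain ⟨x, y, z⟩ := p
  have hz : ∀ i, z i ≠ 0 := hp.1
  have hsurj : Function.Surjective (M.map (Int.cast : ℤ → ℚ)).transpose.mulVecLin := by
    rw [← LinearMap.range_eq_top]
    apply Submodule.eq_top_of_finrank_eq
    have h := Matrix.rank_transpose (M.map (Int.cast : ℤ → ℚ))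
    rw [hM] at h
    simpa [Matrix.rank] using h
  choose b hb using fun j : Fin n => hsurj (Pi.single j 1)
  have hbC : ∀ j k : Fin n, ∑ i, (M i k : ℂ) * (b j i : ℂ) = if k = j then 1 else 0 := by
    intro j k
    have h := congrFun (hb j) k
    simp only [Matrix.mulVecLin_apply, Matrix.mulVec, dotProduct, Matrix.transpose_apply,
      Matrix.map_apply, Pi.single_apply] at h
    have h' := congrArg (fun q : ℚ => (q : ℂ)) h
    push_cast at h'
    rw [h']
    split_ifs <;> simp
  have hu : ∀ j, (∏ i, z i ^ M i j) ≠ 0 := fun j =>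
    Finset.prod_ne_zero_iff.mpr fun i _ => zpow_ne_zero _ (hz i)
  let s : Fin m → ℂ := fun i => ∑ j, (b j i : ℂ) * (-(w j) / ∏ i, z i ^ M i j)
  have hs : ∀ k, ∑ i, (M i k : ℂ) * s i = -(w k) / ∏ i, z i ^ M i k := by
    intro k
    simp only [s, Finset.mul_sum]
    rw [Finset.sum_comm]
    simp only [← mul_assoc, ← Finset.sum_mul, hbC]
    simp
  have hexp : ∀ i, HasDerivAt (fun t : ℝ => z i * Complex.exp (t * s i)) (z i * s i) 0 := by
    intro i
    have h1 : HasDerivAt (fun t : ℝ => (t : ℂ) * s i) (s i) 0 := by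
      simpa using (Complex.ofRealCLM.hasDerivAt (x := (0 : ℝ))).mul_const (s i)
    simpa using h1.cexp.const_mul (z i)
  have hγ : HasDerivAt
      (fun t : ℝ => ((x, y, fun i => z i * Complex.exp (t * s i)) : Ambient m n))
      ((0, 0, fun i => z i * s i) : Ambient m n) 0 :=
    (hasDerivAt_const _ _).prodMk
      ((hasDerivAt_const _ _).prodMk (hasDerivAt_pi.mpr hexp))
  have hdiff : DifferentiableAt ℝ (equations M) (x, y, z) := by
    unfold equations
    refine differentiableAt_pi.mpr fun j => ?_
    refine DifferentiableAt.sub (by fun_prop) (DifferentiableAt.add_const _ ?_)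
    refine (HasFDerivAt.finsetProd (u := Finset.univ)
      (g := fun (i : Fin m) (q : Ambient m n) => q.2.2 i ^ M i j)
      fun i _ => DifferentiableAt.hasFDerivAt ?_).differentiableAt
    have h1 : DifferentiableAt ℝ (fun c : ℂ => c ^ M i j) (z i) :=
      (differentiableAt_zpow.mpr (Or.inl (hz i)) : DifferentiableAt ℂ _ _).restrictScalars ℝ
    exact DifferentiableAt.comp (x, y, z) (g := fun c : ℂ => c ^ M i j)
      (f := fun q : Ambient m n => q.2.2 i) h1 (by fun_prop)
  refine ⟨(0, 0, fun i => z i * s i), ?_⟩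
  have h0 : ((x, y, fun i => z i * Complex.exp (((0 : ℝ) : ℂ) * s i)) : Ambient m n)
      = (x, y, z) := by simp
  have hcomp := HasFDerivAt.comp_hasDerivAt (0 : ℝ) (h0 ▸ hdiff.hasFDerivAt) hγ
  refine HasDerivAt.unique (h0 ▸ hcomp) ?_
  refine hasDerivAt_pi.mpr fun j => ?_
  have hprod : ∀ t : ℝ, ∏ i, (z i * Complex.exp (t * s i)) ^ M i j
      = (∏ i, z i ^ M i j) * Complex.exp (t * (-(w j) / ∏ i, z i ^ M i j)) := by
    intro t
    rw [← hs j, Finset.mul_sum, Complex.exp_sum, ← Finset.prod_mul_distrib]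
    refine Finset.prod_congr rfl fun i _ => ?_
    rw [mul_zpow, ← Complex.exp_int_mul]
    ring_nf
  have h1 : HasDerivAt (fun t : ℝ => (t : ℂ) * (-(w j) / ∏ i, z i ^ M i j))
      (-(w j) / ∏ i, z i ^ M i j) 0 := by
    simpa using (Complex.ofRealCLM.hasDerivAt (x := (0 : ℝ))).mul_const
      (-(w j) / ∏ i, z i ^ M i j)
  have h2 := ((h1.cexp.const_mul (∏ i, z i ^ M i j)).add_const 1).const_sub (x j * y j)
  have h3 : (fun t : ℝ => (equations M ∘
      fun t : ℝ => ((x, y, fun i => z i * Complex.exp (t * s i)) : Ambient m n)) t j)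
      = fun t : ℝ => x j * y j - ((∏ i, z i ^ M i j) *
        Complex.exp (t * (-(w j) / ∏ i, z i ^ M i j)) + 1) := by
    funext t
    simp only [Function.comp, equations, hprod]
  rw [h3]
  convert h2 using 1
  simp [mul_div_cancel₀ _ (hu j)]

end IsolatedCluster

/-! On the fiber over $c=(s,\ell)$ one has $|z_i|=e^{\ell_i}$, so $z$ runs over a torus $T^m$. Given
$z$, put $w_j=\prod_i z_i^{a_{ij}}+1$. The pairs with $x_jy_j=w_j$ and $|x_j|^2-|y_j|^2=s_j$ form
one orbit of the rotation $(e^{i\theta}x_j,e^{-i\theta}y_j)$: a circle, or the origin alone when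
$s_j=0=w_j$.

Since $|w_j-1|=\exp\sum_i a_{ij}\ell_i$, the origin can occur only if $s_j=0=\sum_i a_{ij}\ell_i$.
In that case it does occur: column $j$ is nonzero by full rank, so phases of $z$ can be chosen with
product $-1$. The differential of $|x_j|^2-|y_j|^2$ vanishes there. Hence the regular values are
described by `IsNondegenerate` (`isRegularValue_iff`), an open dense condition.

For such $c$ the circles form a trivial bundle over $T^m$. The sign of $s_j$ alone decides which of
$x_j,y_j$ has the larger modulus; that coordinate never vanishes on the fiber, its modulus is a
smooth function of $w_j$, and its phase is a global coordinate. The phases of the $z_i$ and of these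
coordinates identify the fiber with $T^{n+m}$ (`fiberPhases_fiberPoint`, `range_fiberPoint`). -/

namespace IsolatedCluster

open Filter Topology

/-! ### Smooth embeddings of the torus -/

section Torus

variable {N : ℕ}

/-- Charts of the torus are products of charts of the circle, so an evaluation reads as a linear
projection. Both its smoothness and its derivative follow. -/
theorem writtenInExtChartAt_torus_eval (t : Torus N) (i : Fin N) :
    writtenInExtChartAt (torusModel N) (𝓡 1) t (fun u : Torus N => u i)
      =ᶠ[𝓝[Set.range (torusModel N)] (extChartAt (torusModel N) t t)] fun v => v i := by
  filter_upwards [extChartAt_target_mem_nhdsWithin (I := torusModel N) t] with v hv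
  exact congrFun ((extChartAt (torusModel N) t).right_inv hv) i

theorem contMDiff_torus_eval (i : Fin N) :
    ContMDiff (torusModel N) (𝓡 1) ∞ (fun u : Torus N => u i) := by
  intro t
  rw [contMDiffAt_iff]
  refine ⟨(continuous_apply i).continuousAt, ?_⟩
  exact ContDiffWithinAt.congr_of_eventuallyEq
    (ContinuousLinearMap.proj (R := ℝ) (φ := fun _ : Fin N => EuclideanSpace ℝ (Fin 1))
      i).contDiff.contDiffWithinAt (writtenInExtChartAt_torus_eval t i)
    ((writtenInExtChartAt_torus_eval t i).eq_of_nhdsWithin (Set.mem_range_self _))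

theorem hasMFDerivAt_torus_eval (t : Torus N) (i : Fin N) :
    HasMFDerivAt (torusModel N) (𝓡 1) (fun u : Torus N => u i) t
      (ContinuousLinearMap.proj (R := ℝ) (φ := fun _ : Fin N => EuclideanSpace ℝ (Fin 1)) i) := by
  refine ⟨(continuous_apply i).continuousAt, ?_⟩
  exact HasFDerivWithinAt.congr_of_eventuallyEq
    (ContinuousLinearMap.proj (R := ℝ) (φ := fun _ : Fin N => EuclideanSpace ℝ (Fin 1))
      i).hasFDerivAt.hasFDerivWithinAt (writtenInExtChartAt_torus_eval t i)
    ((writtenInExtChartAt_torus_eval t i).eq_of_nhdsWithin (Set.mem_range_self _))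

theorem contMDiff_circle_coe : ContMDiff (𝓡 1) 𝓘(ℝ, ℂ) ∞ (fun u : Circle => (u : ℂ)) := by
  have := finrank_real_complex_fact'
  exact contMDiff_coe_sphere

theorem mfderiv_circle_coe_injective (u : Circle) :
    Function.Injective (mfderiv (𝓡 1) 𝓘(ℝ, ℂ) (fun u : Circle => (u : ℂ)) u) := by
  have := finrank_real_complex_fact'
  have h := injective_mvfderiv_subtypeVal_sphere (E := ℂ) (n := 1) u
  convert! h

/-- The inclusion of the torus into `ℂᴺ`. -/
def torusCoe (t : Torus N) : Fin N → ℂ := fun i => t i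

theorem contMDiff_torusCoe : ContMDiff (torusModel N) 𝓘(ℝ, Fin N → ℂ) ∞ (torusCoe (N := N)) :=
  contMDiff_pi_space.mpr fun i => contMDiff_circle_coe.comp (contMDiff_torus_eval i)

theorem mfderiv_torusCoe_injective (t : Torus N) :
    Function.Injective (mfderiv (torusModel N) 𝓘(ℝ, Fin N → ℂ) torusCoe t) := by
  have hι : HasMFDerivAt (torusModel N) 𝓘(ℝ, Fin N → ℂ) torusCoe t _ :=
    (contMDiff_torusCoe.mdifferentiableAt (by simp)).hasMFDerivAt
  refine (injective_iff_map_eq_zero _).mpr fun v hv => ?_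
  funext i
  have h1 := (((ContinuousLinearMap.proj (R := ℝ) (φ := fun _ : Fin N => ℂ)
    i).hasFDerivAt (x := torusCoe t)).hasMFDerivAt).comp t hι
  have h2 := ((contMDiff_circle_coe.mdifferentiableAt (x := t i)
    (by simp)).hasMFDerivAt).comp t (hasMFDerivAt_torus_eval t i)
  have h3 := congrArg (fun L => L v) (hasMFDerivAt_unique h1 h2)
  refine (injective_iff_map_eq_zero _).mp (mfderiv_circle_coe_injective (t i)) (v i) ?_
  refine h3.symm.trans ?_
  change (mfderiv (torusModel N) 𝓘(ℝ, Fin N → ℂ) torusCoe t v) i = 0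
  rw [hv]
  rfl

/-- A map of the torus that is the restriction of a smooth map of `ℂᴺ` with a differentiable
left inverse is a smooth embedding. -/
theorem isEmbeddedTorus_of_leftInverse {V : Type*} [NormedAddCommGroup V] [NormedSpace ℝ V]
    (F : (Fin N → ℂ) → V) (G : V → Fin N → ℂ)
    (hF : ∀ t : Torus N, ContDiffAt ℝ ∞ F (torusCoe t))
    (hG : ∀ t : Torus N, DifferentiableAt ℝ G (F (torusCoe t)))
    (hGF : ∀ t : Torus N, G (F (torusCoe t)) = torusCoe t) :
    IsEmbeddedTorus N (Set.range (F ∘ torusCoe)) := by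
  have hsm : ContMDiff (torusModel N) 𝓘(ℝ, V) ∞ (F ∘ torusCoe) := fun t =>
    (hF t).contMDiffAt.comp t (contMDiff_torusCoe t)
  refine ⟨F ∘ torusCoe, hsm, fun t => ?_, ?_, rfl⟩
  -- By the chain rule the injective differential of `torusCoe` factors through that of `F ∘
  -- torusCoe`.
  · have h1 := ((hG t).hasFDerivAt.hasMFDerivAt).comp t
      ((hsm.mdifferentiableAt (x := t) (by simp)).hasMFDerivAt)
    have h2 : G ∘ (F ∘ torusCoe) = torusCoe := funext hGF
    rw [h2] at h1
    have h3 := mfderiv_torusCoe_injective t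
    rw [h1.mfderiv] at h3
    exact Function.Injective.of_comp (f := fderiv ℝ G (F (torusCoe t))) h3
  -- The torus is compact, so continuity and injectivity suffice.
  · refine (Continuous.isClosedEmbedding hsm.continuous fun s t hst => ?_).isEmbedding
    have h := (hGF s).symm.trans ((congrArg G hst).trans (hGF t))
    funext i
    exact Circle.coe_injective (congrFun h i)

end Torus

/-! ### Differentials of the equations and of the fibration -/

section Differentials

variable {m n : ℕ}

theorem differentiableAt_equations (M : Matrix (Fin m) (Fin n) ℤ) {p : Ambient m n}
    (hz : ∀ i, p.2.2 i ≠ 0) : DifferentiableAt ℝ (equations M) p := by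
  unfold equations
  refine differentiableAt_pi.mpr fun j => ?_
  refine DifferentiableAt.sub (by fun_prop) (DifferentiableAt.add_const _ ?_)
  refine (HasFDerivAt.finsetProd (u := Finset.univ)
    (g := fun (i : Fin m) (q : Ambient m n) => q.2.2 i ^ M i j)
    fun i _ => DifferentiableAt.hasFDerivAt ?_).differentiableAt
  have h1 : DifferentiableAt ℝ (fun c : ℂ => c ^ M i j) (p.2.2 i) :=
    (differentiableAt_zpow.mpr (Or.inl (hz i)) : DifferentiableAt ℂ _ _).restrictScalars ℝ
  exact DifferentiableAt.comp p (g := fun c : ℂ => c ^ M i j)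
    (f := fun q : Ambient m n => q.2.2 i) h1 (by fun_prop)

theorem differentiableAt_fibration {p : Ambient m n} (hz : ∀ i, p.2.2 i ≠ 0) :
    DifferentiableAt ℝ (fibration m n) p := by
  unfold fibration
  refine DifferentiableAt.prodMk (differentiableAt_pi.mpr fun j => ?_)
    (differentiableAt_pi.mpr fun k => ?_)
  · exact DifferentiableAt.sub (DifferentiableAt.norm_sq ℝ (by fun_prop))
      (DifferentiableAt.norm_sq ℝ (by fun_prop))
  · exact DifferentiableAt.log (DifferentiableAt.norm ℝ (by fun_prop) (hz k))
      (norm_ne_zero_iff.mpr (hz k))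

/-- The curve through `(x, y, z)` with velocity `(a, b, (zᵢ sᵢ))`. -/
noncomputable def expCurve (p : Ambient m n) (a b : Fin n → ℂ) (s : Fin m → ℂ) (t : ℝ) :
    Ambient m n :=
  (fun j => p.1 j + t * a j, fun j => p.2.1 j + t * b j,
    fun i => p.2.2 i * Complex.exp (t * s i))

theorem hasDerivAt_ofReal_mul (c : ℂ) (t : ℝ) :
    HasDerivAt (fun t : ℝ => (t : ℂ) * c) c t := by
  simpa using (Complex.ofRealCLM.hasDerivAt (x := t)).mul_const c

theorem expCurve_zero (p : Ambient m n) (a b : Fin n → ℂ) (s : Fin m → ℂ) :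
    expCurve p a b s 0 = p := by
  simp [expCurve]

theorem hasDerivAt_expCurve (p : Ambient m n) (a b : Fin n → ℂ) (s : Fin m → ℂ) :
    HasDerivAt (expCurve p a b s) (a, b, fun i => p.2.2 i * s i) 0 := by
  refine HasDerivAt.prodMk (hasDerivAt_pi.mpr fun j => ?_)
    (HasDerivAt.prodMk (hasDerivAt_pi.mpr fun j => ?_) (hasDerivAt_pi.mpr fun i => ?_))
  · exact (hasDerivAt_ofReal_mul (a j) 0).const_add _
  · exact (hasDerivAt_ofReal_mul (b j) 0).const_add _
  · simpa using (hasDerivAt_ofReal_mul (s i) 0).cexp.const_mul (p.2.2 i)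

/-- Along `expCurve` Laurent monomials in $z$ become exponentials and each $\log|z_k|$ becomes
affine in $t$, so differentials reduce to one-variable derivatives. Where all $z_i\ne0$, every
tangent vector has this form. -/
theorem fderiv_apply_of_expCurve {E : Type*} [NormedAddCommGroup E] [NormedSpace ℝ E]
    {f : Ambient m n → E} {p : Ambient m n} (hf : DifferentiableAt ℝ f p)
    {a b : Fin n → ℂ} {s : Fin m → ℂ} {e : E}
    (h : HasDerivAt (fun t => f (expCurve p a b s t)) e 0) :
    fderiv ℝ f p (a, b, fun i => p.2.2 i * s i) = e := by
  have h0 := expCurve_zero p a b s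
  have hd : HasFDerivAt f (fderiv ℝ f p) (expCurve p a b s 0) := by
    rw [h0]; exact hf.hasFDerivAt
  exact (hd.comp_hasDerivAt (0 : ℝ) (hasDerivAt_expCurve p a b s)).unique h

theorem fderiv_equations (M : Matrix (Fin m) (Fin n) ℤ) {p : Ambient m n}
    (hz : ∀ i, p.2.2 i ≠ 0) (a b : Fin n → ℂ) (s : Fin m → ℂ) :
    fderiv ℝ (equations M) p (a, b, fun i => p.2.2 i * s i) = fun j =>
      a j * p.2.1 j + p.1 j * b j - (∏ i, p.2.2 i ^ M i j) * ∑ i, (M i j : ℂ) * s i := by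
  refine fderiv_apply_of_expCurve (differentiableAt_equations M hz)
    (hasDerivAt_pi.mpr fun j => ?_)
  have hprod : ∀ t : ℝ, ∏ i, (p.2.2 i * Complex.exp (t * s i)) ^ M i j
      = (∏ i, p.2.2 i ^ M i j) * Complex.exp (t * ∑ i, (M i j : ℂ) * s i) := by
    intro t
    rw [Finset.mul_sum, Complex.exp_sum, ← Finset.prod_mul_distrib]
    refine Finset.prod_congr rfl fun i _ => ?_
    rw [mul_zpow, ← Complex.exp_int_mul]
    ring_nf
  simp only [equations, expCurve, hprod]
  have h1 := ((hasDerivAt_ofReal_mul (a j) 0).const_add (p.1 j)).mul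
    ((hasDerivAt_ofReal_mul (b j) 0).const_add (p.2.1 j))
  have h2 := ((hasDerivAt_ofReal_mul (∑ i, (M i j : ℂ) * s i) 0).cexp.const_mul
    (∏ i, p.2.2 i ^ M i j)).add_const 1
  exact (h1.sub h2).congr_deriv (by simp)

theorem fderiv_fibration {p : Ambient m n} (hz : ∀ i, p.2.2 i ≠ 0) (a b : Fin n → ℂ)
    (s : Fin m → ℂ) :
    fderiv ℝ (fibration m n) p (a, b, fun i => p.2.2 i * s i) =
      (fun j => 2 * inner ℝ (p.1 j) (a j) - 2 * inner ℝ (p.2.1 j) (b j), fun k => (s k).re) := by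
  refine fderiv_apply_of_expCurve (differentiableAt_fibration hz)
    (HasDerivAt.prodMk (hasDerivAt_pi.mpr fun j => ?_) (hasDerivAt_pi.mpr fun k => ?_))
  · have h1 := ((hasDerivAt_ofReal_mul (a j) 0).const_add (p.1 j)).norm_sq
    have h2 := ((hasDerivAt_ofReal_mul (b j) 0).const_add (p.2.1 j)).norm_sq
    exact (h1.sub h2).congr_deriv (by simp)
  · have h : ∀ t : ℝ, Real.log ‖(expCurve p a b s t).2.2 k‖
        = Real.log ‖p.2.2 k‖ + t * (s k).re := by
      intro t
      simp only [expCurve, norm_mul, Complex.norm_exp]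
      rw [Real.log_mul (norm_ne_zero_iff.mpr (hz k)) (Real.exp_pos _).ne', Real.log_exp]
      simp
    simp only [h]
    simpa using ((hasDerivAt_id (0 : ℝ)).mul_const (s k).re).const_add (Real.log ‖p.2.2 k‖)

end Differentials

/-! ### The circle $xy=w$, $|x|^2-|y|^2=s$ -/

section Hyperbola

/-- For `x * y = w` and `‖x‖² - ‖y‖² = s`, the larger of `‖x‖` and `‖y‖`. -/
noncomputable def majorRadius (s : ℝ) (w : ℂ) : ℝ :=
  √((|s| + √(s ^ 2 + 4 * ‖w‖ ^ 2)) / 2)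

/-- The parametrization by the phase `t` of the larger coordinate of the circle of solutions
of `x * y = w`, `‖x‖² - ‖y‖² = s`. -/
noncomputable def hyperbolaPoint (s : ℝ) (w t : ℂ) : ℂ × ℂ :=
  if 0 ≤ s then (majorRadius s w * t, w * starRingEnd ℂ t / majorRadius s w)
  else (w * starRingEnd ℂ t / majorRadius s w, majorRadius s w * t)

/-- The phase of `x` or `y`, according to the sign of `s`. -/
noncomputable def majorPhase (s : ℝ) (q : ℂ × ℂ) : ℂ :=
  if 0 ≤ s then q.1 / ‖q.1‖ else q.2 / ‖q.2‖

theorem majorRadius_sq (s : ℝ) (w : ℂ) :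
    majorRadius s w ^ 2 = (|s| + √(s ^ 2 + 4 * ‖w‖ ^ 2)) / 2 :=
  Real.sq_sqrt (by positivity)

/-- If $r$ is the larger modulus, the smaller one is $|w|/r$, and $r^2-|w|^2/r^2=|s|$ is a quadratic
equation for $r^2$. -/
theorem majorRadius_quadratic (s : ℝ) (w : ℂ) :
    (majorRadius s w ^ 2) ^ 2 - |s| * majorRadius s w ^ 2 = ‖w‖ ^ 2 := by
  rw [majorRadius_sq]
  have h := Real.sq_sqrt (show 0 ≤ s ^ 2 + 4 * ‖w‖ ^ 2 by positivity)
  have h' := sq_abs s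
  linear_combination h / 4 - h' / 4

theorem majorRadius_pos {s : ℝ} {w : ℂ} (h : s ≠ 0 ∨ w ≠ 0) : 0 < majorRadius s w := by
  refine Real.sqrt_pos.mpr ?_
  rcases h with h | h <;> positivity

theorem majorRadius_eq_zero {s : ℝ} {w : ℂ} (h : ¬(s ≠ 0 ∨ w ≠ 0)) : majorRadius s w = 0 := by
  push Not at h
  simp [majorRadius, h.1, h.2]

theorem hyperbolaPoint_mul (s : ℝ) (w : ℂ) {t : ℂ} (ht : ‖t‖ = 1) :
    (hyperbolaPoint s w t).1 * (hyperbolaPoint s w t).2 = w := by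
  have htt : t * starRingEnd ℂ t = 1 := by
    rw [Complex.mul_conj, Complex.normSq_eq_norm_sq, ht]; simp
  by_cases h : s ≠ 0 ∨ w ≠ 0
  · have hr : (majorRadius s w : ℂ) ≠ 0 := by exact_mod_cast (majorRadius_pos h).ne'
    unfold hyperbolaPoint
    split_ifs
    · field_simp
      linear_combination w * htt
    · field_simp
      linear_combination w * htt
  -- In the degenerate case the radius is $0$ and division by zero gives $0$, so the point is the
  -- origin. This case is needed at critical values.
  · rw [hyperbolaPoint, majorRadius_eq_zero h]
    push Not at h
    split_ifs <;> simp [h.2]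

theorem hyperbolaPoint_norm (s : ℝ) (w : ℂ) {t : ℂ} (ht : ‖t‖ = 1) :
    ‖(hyperbolaPoint s w t).1‖ ^ 2 - ‖(hyperbolaPoint s w t).2‖ ^ 2 = s := by
  by_cases h : s ≠ 0 ∨ w ≠ 0
  · have hr := majorRadius_pos h
    have hq := majorRadius_quadratic s w
    unfold hyperbolaPoint
    split_ifs with hs
    · rw [abs_of_nonneg hs] at hq
      simp only [norm_mul, norm_div, Complex.norm_real, Complex.norm_conj, ht,
        Real.norm_of_nonneg hr.le]
      field_simp
      linear_combination hq
    · rw [abs_of_neg (not_le.mp hs)] at hq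
      simp only [norm_mul, norm_div, Complex.norm_real, Complex.norm_conj, ht,
        Real.norm_of_nonneg hr.le]
      field_simp
      linear_combination -hq
  · rw [hyperbolaPoint, majorRadius_eq_zero h]
    push Not at h
    split_ifs <;> simp [h.1]

theorem majorPhase_hyperbolaPoint {s : ℝ} {w : ℂ} (h : s ≠ 0 ∨ w ≠ 0) {t : ℂ} (ht : ‖t‖ = 1) :
    majorPhase s (hyperbolaPoint s w t) = t := by
  have hr := majorRadius_pos h
  have hr' : (majorRadius s w : ℂ) ≠ 0 := by exact_mod_cast hr.ne'
  unfold majorPhase hyperbolaPoint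
  split_ifs <;>
  · simp only [norm_mul, Complex.norm_real, ht, Real.norm_of_nonneg hr.le]
    push_cast
    field_simp

/-- The inner root collapses because $s^2+4|xy|^2=(|x|^2+|y|^2)^2$. -/
theorem majorRadius_eq {s : ℝ} {x y : ℂ} (h : ‖x‖ ^ 2 - ‖y‖ ^ 2 = s) :
    majorRadius s (x * y) = if 0 ≤ s then ‖x‖ else ‖y‖ := by
  have h1 : √(s ^ 2 + 4 * ‖x * y‖ ^ 2) = ‖x‖ ^ 2 + ‖y‖ ^ 2 := by
    rw [Real.sqrt_eq_iff_mul_self_eq (by positivity) (by positivity), ← h, norm_mul]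
    ring
  rw [majorRadius, h1]
  split_ifs with hs
  · rw [abs_of_nonneg hs, ← h, Real.sqrt_eq_iff_mul_self_eq (by nlinarith [sq_nonneg ‖x‖])
      (by positivity)]
    ring
  · rw [abs_of_neg (not_le.mp hs), ← h, Real.sqrt_eq_iff_mul_self_eq
      (by nlinarith [sq_nonneg ‖y‖]) (by positivity)]
    ring

theorem norm_majorPhase {s : ℝ} {x y : ℂ} (h : ‖x‖ ^ 2 - ‖y‖ ^ 2 = s)
    (h0 : s ≠ 0 ∨ x * y ≠ 0) : ‖majorPhase s (x, y)‖ = 1 := by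
  have hr := majorRadius_pos h0
  rw [majorRadius_eq h] at hr
  unfold majorPhase
  split_ifs at hr ⊢ <;>
  · rw [norm_div, Complex.norm_real, norm_norm, div_self hr.ne']

theorem hyperbolaPoint_majorPhase {s : ℝ} {x y : ℂ} (h : ‖x‖ ^ 2 - ‖y‖ ^ 2 = s)
    (h0 : s ≠ 0 ∨ x * y ≠ 0) : hyperbolaPoint s (x * y) (majorPhase s (x, y)) = (x, y) := by
  have hr := majorRadius_pos h0
  rw [hyperbolaPoint, majorRadius_eq h]
  rw [majorRadius_eq h] at hr
  unfold majorPhase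
  split_ifs at hr ⊢
  · have hr' : (‖x‖ : ℂ) ≠ 0 := by exact_mod_cast hr.ne'
    have hx : x * starRingEnd ℂ x = (‖x‖ : ℂ) ^ 2 := Complex.mul_conj' x
    refine Prod.ext (mul_div_cancel₀ _ hr') ?_
    simp only [map_div₀, Complex.conj_ofReal]
    field_simp
    linear_combination y * hx
  · have hr' : (‖y‖ : ℂ) ≠ 0 := by exact_mod_cast hr.ne'
    have hy : y * starRingEnd ℂ y = (‖y‖ : ℂ) ^ 2 := Complex.mul_conj' y
    refine Prod.ext ?_ (mul_div_cancel₀ _ hr')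
    simp only [map_div₀, Complex.conj_ofReal]
    field_simp
    linear_combination x * hy

end Hyperbola

/-! ### Regular values -/

section RegularValues

variable {m n : ℕ}

theorem norm_prod_zpow (a : Fin m → ℤ) {z : Fin m → ℂ} (hz : ∀ i, z i ≠ 0) :
    ‖∏ i, z i ^ a i‖ = Real.exp (∑ i, (a i : ℝ) * Real.log ‖z i‖) := by
  rw [norm_prod, Real.exp_sum]
  refine Finset.prod_congr rfl fun i _ => ?_
  rw [norm_zpow, mul_comm, Real.exp_mul, Real.exp_log (norm_pos_iff.mpr (hz i)),
    Real.rpow_intCast]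

theorem prod_zpow_add_one_ne_zero (a : Fin m → ℤ) {z : Fin m → ℂ} (hz : ∀ i, z i ≠ 0)
    (h : ∑ i, (a i : ℝ) * Real.log ‖z i‖ ≠ 0) : (∏ i, z i ^ a i) + 1 ≠ 0 := by
  intro h0
  have h1 := norm_prod_zpow a hz
  rw [eq_neg_of_add_eq_zero_left h0, norm_neg, norm_one, eq_comm, Real.exp_eq_one_iff] at h1
  exact h h1

theorem exists_ne_zero_of_rank_eq (M : Matrix (Fin m) (Fin n) ℤ)
    (hM : (M.map (Int.cast : ℤ → ℚ)).rank = n) (j : Fin n) : ∃ i, M i j ≠ 0 := by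
  have hsurj : Function.Surjective (M.map (Int.cast : ℤ → ℚ)).transpose.mulVecLin := by
    rw [← LinearMap.range_eq_top]
    apply Submodule.eq_top_of_finrank_eq
    have h := Matrix.rank_transpose (M.map (Int.cast : ℤ → ℚ))
    rw [hM] at h
    simpa [Matrix.rank] using h
  by_contra! h
  obtain ⟨b, hb⟩ := hsurj (Pi.single j 1)
  have h1 := congrFun hb j
  simp [Matrix.vecMul, dotProduct, h] at h1

theorem exists_infinitesimal_solution {x y : ℂ} (h : ¬(x = 0 ∧ y = 0)) (e : ℂ) (α : ℝ) :
    ∃ a b : ℂ, a * y + x * b = e ∧ 2 * inner ℝ x a - 2 * inner ℝ y b = α := by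
  have hD : 0 < x.re ^ 2 + x.im ^ 2 + (y.re ^ 2 + y.im ^ 2) := by
    by_contra! h0
    have hx : x.re ^ 2 + x.im ^ 2 = 0 ∧ y.re ^ 2 + y.im ^ 2 = 0 := by
      constructor <;> linarith [sq_nonneg x.re, sq_nonneg x.im, sq_nonneg y.re, sq_nonneg y.im]
    refine h ⟨Complex.normSq_eq_zero.mp ?_, Complex.normSq_eq_zero.mp ?_⟩
    · rw [Complex.normSq_apply]; linear_combination hx.1
    · rw [Complex.normSq_apply]; linear_combination hx.2
  set D := x.re ^ 2 + x.im ^ 2 + (y.re ^ 2 + y.im ^ 2) with hDdef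
  have hDC : x * starRingEnd ℂ x + y * starRingEnd ℂ y = D := by
    rw [Complex.mul_conj, Complex.mul_conj, ← Complex.ofReal_add, hDdef, Complex.normSq_apply,
      Complex.normSq_apply]
    congr 1
    ring
  have hDC0 : (D : ℂ) ≠ 0 := by exact_mod_cast hD.ne'
  -- The direction $(\bar y,\bar x)e$ solves the complex equation up to the factor $D$ and
  -- contributes nothing to the real one; $(x,-y)$ does the reverse, contributing $2D$.
  refine ⟨(D⁻¹ : ℝ) * (starRingEnd ℂ y * e) + (α / (2 * D) : ℝ) * x,
    (D⁻¹ : ℝ) * (starRingEnd ℂ x * e) - (α / (2 * D) : ℝ) * y, ?_, ?_⟩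
  · push_cast
    field_simp
    linear_combination 2 * e * hDC
  · simp only [Complex.inner, Complex.mul_re, Complex.mul_im, Complex.add_re, Complex.add_im,
      Complex.sub_re, Complex.sub_im, Complex.conj_re, Complex.conj_im, Complex.ofReal_re,
      Complex.ofReal_im]
    field_simp
    rw [hDdef]
    ring

/-- `c` is not a critical value, in terms of the coordinates. -/
def IsNondegenerate (M : Matrix (Fin m) (Fin n) ℤ) (c : Base m n) : Prop :=
  ∀ j, c.1 j ≠ 0 ∨ ∑ i, (M i j : ℝ) * c.2 i ≠ 0

theorem mul_eq_of_mem_totalSpace {M : Matrix (Fin m) (Fin n) ℤ} {p : Ambient m n}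
    (hp : p ∈ totalSpace M) (j : Fin n) : p.1 j * p.2.1 j = (∏ i, p.2.2 i ^ M i j) + 1 :=
  sub_eq_zero.mp (congrFun hp.2 j)

theorem IsNondegenerate.ne_zero {M : Matrix (Fin m) (Fin n) ℤ} {c : Base m n}
    (hc : IsNondegenerate M c) {z : Fin m → ℂ} (hz : ∀ i, z i ≠ 0)
    (hl : ∀ i, Real.log ‖z i‖ = c.2 i) (j : Fin n) :
    c.1 j ≠ 0 ∨ (∏ i, z i ^ M i j) + 1 ≠ 0 := by
  refine (hc j).imp id fun h => prod_zpow_add_one_ne_zero (fun i => M i j) hz ?_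
  simpa only [hl] using h

theorem IsNondegenerate.isRegularValue {M : Matrix (Fin m) (Fin n) ℤ} {c : Base m n}
    (hc : IsNondegenerate M c) : IsRegularValue M c := by
  rintro p ⟨hp, rfl⟩ ⟨α, β⟩
  have hne : ∀ j, ¬(p.1 j = 0 ∧ p.2.1 j = 0) := by
    rintro j ⟨hx, hy⟩
    have h := hc.ne_zero hp.1 (fun _ => rfl) j
    rw [← mul_eq_of_mem_totalSpace hp j] at h
    simp [fibration, hx, hy] at h
  choose a b hab hα using fun j => exists_infinitesimal_solution (hne j)
    ((∏ i, p.2.2 i ^ M i j) * ∑ i, (M i j : ℂ) * (β i : ℂ)) (α j)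
  -- The velocity of $z$ realizes the logarithmic part $\beta$; the pairs $(a_j,b_j)$ compensate the
  -- resulting change of the monomials and realize $\alpha$.
  refine ⟨(a, b, fun i => p.2.2 i * (β i : ℂ)), ?_, ?_⟩
  · change fderiv ℝ (equations M) p _ = 0
    rw [fderiv_equations M hp.1]
    funext j
    rw [hab]
    simp
  · rw [fderiv_fibration hp.1]
    exact Prod.ext (funext hα) (funext fun k => Complex.ofReal_re _)

theorem exists_mem_fiber (M : Matrix (Fin m) (Fin n) ℤ) (c : Base m n) {z : Fin m → ℂ}
    (hz : ∀ i, z i ≠ 0) (hl : ∀ i, Real.log ‖z i‖ = c.2 i) {t : Fin n → ℂ}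
    (ht : ∀ j, ‖t j‖ = 1) :
    ((fun j => (hyperbolaPoint (c.1 j) ((∏ i, z i ^ M i j) + 1) (t j)).1,
      fun j => (hyperbolaPoint (c.1 j) ((∏ i, z i ^ M i j) + 1) (t j)).2, z) : Ambient m n)
      ∈ fiber M c :=
  ⟨⟨hz, funext fun j => sub_eq_zero.mpr (hyperbolaPoint_mul _ _ (ht j))⟩,
    Prod.ext (funext fun j => hyperbolaPoint_norm _ _ (ht j)) (funext hl)⟩

theorem IsRegularValue.isNondegenerate {M : Matrix (Fin m) (Fin n) ℤ}
    (hM : (M.map (Int.cast : ℤ → ℚ)).rank = n) {c : Base m n} (hc : IsRegularValue M c) :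
    IsNondegenerate M c := by
  by_contra h
  simp only [IsNondegenerate, not_forall, not_or, not_not] at h
  obtain ⟨j, hs, hl⟩ := h
  obtain ⟨i₀, hi₀⟩ := exists_ne_zero_of_rank_eq M hM j
  -- Turning the single coordinate $z_{i_0}$ by $\pi/a_{i_0j}$ gives the $j$-th monomial the phase
  -- $-1$; its modulus is already $1$.
  let u : Fin m → ℂ := fun i =>
    if i = i₀ then Complex.exp ((Real.pi / M i₀ j : ℝ) * Complex.I) else 1
  have hu : ∀ i, ‖u i‖ = 1 := by
    intro i
    simp only [u]
    split_ifs
    · exact Complex.norm_exp_ofReal_mul_I _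
    · exact norm_one
  let z : Fin m → ℂ := fun i => (Real.exp (c.2 i) : ℂ) * u i
  have hnorm : ∀ i, ‖z i‖ = Real.exp (c.2 i) := fun i => by
    rw [norm_mul, hu, mul_one, Complex.norm_real, Real.norm_of_nonneg (Real.exp_pos _).le]
  have hz : ∀ i, z i ≠ 0 := fun i =>
    norm_pos_iff.mp (by rw [hnorm]; exact Real.exp_pos _)
  have hlog : ∀ i, Real.log ‖z i‖ = c.2 i := fun i => by rw [hnorm, Real.log_exp]
  have hprod : (∏ i, z i ^ M i j) + 1 = 0 := by
    have h1 : ∏ i, ((Real.exp (c.2 i) : ℝ) : ℂ) ^ M i j = 1 := by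
      have : ∏ i, Real.exp (c.2 i) ^ M i j = 1 := by
        rw [← Real.exp_zero, ← hl, Real.exp_sum]
        refine Finset.prod_congr rfl fun i _ => ?_
        rw [mul_comm, Real.exp_mul, Real.rpow_intCast]
      exact_mod_cast this
    have h2 : ∏ i, u i ^ M i j = -1 := by
      rw [Finset.prod_eq_single i₀ (fun i _ hi => by simp [u, hi]) (by simp)]
      simp only [u, if_true]
      rw [← Complex.exp_int_mul, ← Complex.exp_pi_mul_I]
      have : (M i₀ j : ℂ) ≠ 0 := by exact_mod_cast hi₀
      congr 1
      push_cast
      field_simp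
    simp only [z, mul_zpow, Finset.prod_mul_distrib, h1, h2]
    ring
  have hmem := exists_mem_fiber M c hz hlog (t := fun _ => 1) fun _ => norm_one
  set p : Ambient m n := _ with hp
  replace hmem : p ∈ fiber M c := hmem
  -- At `p` both $x_j$ and $y_j$ vanish, so the $j$-th component of the differential is zero and
  -- cannot equal $1$.
  obtain ⟨v, -, hv⟩ := hc _ hmem (Pi.single j 1, 0)
  have hv' : v = (v.1, v.2.1, fun i => z i * (v.2.2 i / z i)) :=
    Prod.ext rfl (Prod.ext rfl (funext fun i => (mul_div_cancel₀ _ (hz i)).symm))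
  rw [hv', fderiv_fibration (p := p) hz] at hv
  have h := congrFun (congrArg Prod.fst hv) j
  have hr : majorRadius 0 0 = 0 := majorRadius_eq_zero (by simp)
  simp [p, hs, hprod, hyperbolaPoint, hr] at h

theorem isRegularValue_iff {M : Matrix (Fin m) (Fin n) ℤ}
    (hM : (M.map (Int.cast : ℤ → ℚ)).rank = n) {c : Base m n} :
    IsRegularValue M c ↔ IsNondegenerate M c :=
  ⟨fun h => h.isNondegenerate hM, fun h => h.isRegularValue⟩

theorem isOpen_isNondegenerate (M : Matrix (Fin m) (Fin n) ℤ) :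
    IsOpen {c : Base m n | IsNondegenerate M c} := by
  simp only [IsNondegenerate, Set.ofPred_forall, Set.ofPred_or]
  exact isOpen_iInter_of_finite fun j =>
    (isOpen_ne_fun (by fun_prop) continuous_const).union
      (isOpen_ne_fun (by fun_prop) continuous_const)

theorem dense_isNondegenerate (M : Matrix (Fin m) (Fin n) ℤ) :
    Dense {c : Base m n | IsNondegenerate M c} := by
  have h : Dense ((Set.univ.pi fun _ : Fin n => ({0}ᶜ : Set ℝ)) ×ˢ
      (Set.univ : Set (Fin m → ℝ))) :=
    (dense_pi _ fun _ _ => dense_compl_singleton 0).prod dense_univ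
  -- It is enough that all $s_j$ are nonzero.
  exact h.mono fun c hc j => Or.inl (hc.1 j trivial)

end RegularValues

/-! ### Phases as global coordinates on the fiber -/

section FiberParametrization

variable {m n : ℕ}

/-- Nondegeneracy makes both radicands and the radius positive, so the square roots and the quotient
are smooth. The case distinction depends only on the constant $s$. -/
theorem contDiffAt_hyperbolaPoint {E : Type*} [NormedAddCommGroup E] [NormedSpace ℝ E]
    {f g : E → ℂ} {e : E} (hf : ContDiffAt ℝ ∞ f e) (hg : ContDiffAt ℝ ∞ g e) {s : ℝ}
    (h : s ≠ 0 ∨ f e ≠ 0) : ContDiffAt ℝ ∞ (fun e => hyperbolaPoint s (f e) (g e)) e := by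
  have hr : ContDiffAt ℝ ∞ (fun e => majorRadius s (f e)) e := by
    unfold majorRadius
    refine ContDiffAt.sqrt (ContDiffAt.div_const (contDiffAt_const.add (ContDiffAt.sqrt
      (contDiffAt_const.add (contDiffAt_const.mul (hf.norm_sq ℝ))) ?_)) 2) ?_
    · rcases h with h | h <;> positivity
    · rcases h with h | h <;> positivity
  have hr' : ContDiffAt ℝ ∞ (fun e => (majorRadius s (f e) : ℂ)) e :=
    Complex.ofRealCLM.contDiff.contDiffAt.comp e hr
  have h1 := hr'.mul hg
  have h2 : ContDiffAt ℝ ∞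
      (fun e => f e * starRingEnd ℂ (g e) / (majorRadius s (f e) : ℂ)) e :=
    (hf.mul (Complex.conjCLE.contDiff.contDiffAt.comp e hg)).mul
      (hr'.inv (by exact_mod_cast (majorRadius_pos h).ne'))
  unfold hyperbolaPoint
  split_ifs
  · exact h1.prodMk h2
  · exact h2.prodMk h1

theorem differentiableAt_majorPhase {s : ℝ} {x y : ℂ} (h : ‖x‖ ^ 2 - ‖y‖ ^ 2 = s)
    (h0 : s ≠ 0 ∨ x * y ≠ 0) : DifferentiableAt ℝ (majorPhase s) (x, y) := by
  have hr := majorRadius_pos h0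
  rw [majorRadius_eq h] at hr
  have key : ∀ {f : ℂ × ℂ → ℂ}, DifferentiableAt ℝ f (x, y) → 0 < ‖f (x, y)‖ →
      DifferentiableAt ℝ (fun q => f q / (‖f q‖ : ℂ)) (x, y) := fun {f} hf hpos => by
    have h1 : DifferentiableAt ℝ (fun q => (‖f q‖ : ℂ)) (x, y) :=
      Complex.ofRealCLM.differentiableAt.comp _ (hf.norm ℝ (norm_pos_iff.mp hpos))
    exact hf.mul (h1.inv (by exact_mod_cast hpos.ne'))
  unfold majorPhase
  split_ifs at hr ⊢
  · exact key differentiableAt_fst hr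
  · exact key differentiableAt_snd hr

/-- The coordinates `z` of the point of the fiber over `c` with phases `τ`. -/
noncomputable def polarCoords (c : Base m n) (τ : Fin (n + m) → ℂ) (i : Fin m) : ℂ :=
  (Real.exp (c.2 i) : ℂ) * τ (Fin.natAdd n i)

/-- The point of the fiber over `c` with phases `τ`. -/
noncomputable def fiberPoint (M : Matrix (Fin m) (Fin n) ℤ) (c : Base m n)
    (τ : Fin (n + m) → ℂ) : Ambient m n :=
  (fun j => (hyperbolaPoint (c.1 j) ((∏ i, polarCoords c τ i ^ M i j) + 1)
      (τ (Fin.castAdd m j))).1,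
    fun j => (hyperbolaPoint (c.1 j) ((∏ i, polarCoords c τ i ^ M i j) + 1)
      (τ (Fin.castAdd m j))).2,
    polarCoords c τ)

/-- The phases of a point of the fiber over `c`. -/
noncomputable def fiberPhases (c : Base m n) (p : Ambient m n) : Fin (n + m) → ℂ :=
  Fin.addCases (fun j => majorPhase (c.1 j) (p.1 j, p.2.1 j))
    (fun i => p.2.2 i / (Real.exp (c.2 i) : ℂ))

theorem norm_torusCoe {N : ℕ} (t : Torus N) (k : Fin N) : ‖torusCoe t k‖ = 1 :=
  Circle.norm_coe _

theorem norm_polarCoords (c : Base m n) (t : Torus (n + m)) (i : Fin m) :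
    ‖polarCoords c (torusCoe t) i‖ = Real.exp (c.2 i) := by
  rw [polarCoords, norm_mul, norm_torusCoe, mul_one, Complex.norm_real,
    Real.norm_of_nonneg (Real.exp_pos _).le]

theorem polarCoords_ne_zero (c : Base m n) (t : Torus (n + m)) (i : Fin m) :
    polarCoords c (torusCoe t) i ≠ 0 :=
  norm_pos_iff.mp (by rw [norm_polarCoords]; exact Real.exp_pos _)

theorem log_norm_polarCoords (c : Base m n) (t : Torus (n + m)) (i : Fin m) :
    Real.log ‖polarCoords c (torusCoe t) i‖ = c.2 i := by
  rw [norm_polarCoords, Real.log_exp]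

theorem fiberPoint_mem_fiber (M : Matrix (Fin m) (Fin n) ℤ) (c : Base m n)
    (t : Torus (n + m)) : fiberPoint M c (torusCoe t) ∈ fiber M c :=
  exists_mem_fiber M c (polarCoords_ne_zero c t) (log_norm_polarCoords c t)
    fun _ => norm_torusCoe t _

theorem contDiffAt_fiberPoint {M : Matrix (Fin m) (Fin n) ℤ} {c : Base m n}
    (hc : IsNondegenerate M c) (t : Torus (n + m)) :
    ContDiffAt ℝ ∞ (fiberPoint M c) (torusCoe t) := by
  have hz : ∀ i, ContDiffAt ℝ ∞ (fun τ => polarCoords c τ i) (torusCoe t) := fun i =>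
    contDiffAt_const.mul (contDiff_apply ℝ ℂ _).contDiffAt
  have hu : ∀ j, ContDiffAt ℝ ∞ (fun τ => (∏ i, polarCoords c τ i ^ M i j) + 1)
      (torusCoe t) := fun j => by
    refine (contDiffAt_prod fun i _ => ?_).add contDiffAt_const
    have h1 : AnalyticAt ℝ (fun w : ℂ => w ^ M i j) (polarCoords c (torusCoe t) i) :=
      analyticAt_id.fun_zpow (polarCoords_ne_zero c t i)
    exact h1.contDiffAt.comp (torusCoe t) (hz i)
  have hh := fun j => contDiffAt_hyperbolaPoint (hu j)
    ((contDiff_apply ℝ ℂ (Fin.castAdd m j)).contDiffAt (x := torusCoe t))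
    (hc.ne_zero (polarCoords_ne_zero c t) (log_norm_polarCoords c t) j)
  exact (contDiffAt_pi.mpr fun j => (hh j).fst).prodMk
    ((contDiffAt_pi.mpr fun j => (hh j).snd).prodMk (contDiffAt_pi.mpr hz))

theorem IsNondegenerate.ne_zero_of_mem_fiber {M : Matrix (Fin m) (Fin n) ℤ} {c : Base m n}
    (hc : IsNondegenerate M c) {p : Ambient m n} (hp : p ∈ fiber M c) (j : Fin n) :
    c.1 j ≠ 0 ∨ p.1 j * p.2.1 j ≠ 0 := by
  rw [mul_eq_of_mem_totalSpace hp.1]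
  exact hc.ne_zero hp.1.1 (fun i => congrFun (congrArg Prod.snd hp.2) i) j

theorem norm_sq_sub_of_mem_fiber {M : Matrix (Fin m) (Fin n) ℤ} {c : Base m n}
    {p : Ambient m n} (hp : p ∈ fiber M c) (j : Fin n) :
    ‖p.1 j‖ ^ 2 - ‖p.2.1 j‖ ^ 2 = c.1 j :=
  congrFun (congrArg Prod.fst hp.2) j

theorem differentiableAt_fiberPhases {M : Matrix (Fin m) (Fin n) ℤ} {c : Base m n}
    (hc : IsNondegenerate M c) {p : Ambient m n} (hp : p ∈ fiber M c) :
    DifferentiableAt ℝ (fiberPhases c) p := by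
  refine differentiableAt_pi.mpr fun k => ?_
  unfold fiberPhases
  refine Fin.addCases (fun j => ?_) (fun i => ?_) k
  · simp only [Fin.addCases_left]
    exact (differentiableAt_majorPhase (norm_sq_sub_of_mem_fiber hp j)
      (hc.ne_zero_of_mem_fiber hp j)).comp p
      (f := fun p : Ambient m n => (p.1 j, p.2.1 j)) (by fun_prop)
  · simp only [Fin.addCases_right, div_eq_mul_inv]
    fun_prop

theorem fiberPhases_fiberPoint {M : Matrix (Fin m) (Fin n) ℤ} {c : Base m n}
    (hc : IsNondegenerate M c) (t : Torus (n + m)) :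
    fiberPhases c (fiberPoint M c (torusCoe t)) = torusCoe t := by
  funext k
  refine Fin.addCases (fun j => ?_) (fun i => ?_) k
  · simp only [fiberPhases, Fin.addCases_left]
    exact majorPhase_hyperbolaPoint
      (hc.ne_zero (polarCoords_ne_zero c t) (log_norm_polarCoords c t) j) (norm_torusCoe t _)
  · simp only [fiberPhases, Fin.addCases_right]
    exact mul_div_cancel_left₀ _ (by exact_mod_cast (Real.exp_pos _).ne')

theorem range_fiberPoint {M : Matrix (Fin m) (Fin n) ℤ} {c : Base m n}
    (hc : IsNondegenerate M c) :
    Set.range (fiberPoint M c ∘ torusCoe) = fiber M c := by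
  refine Set.Subset.antisymm (Set.range_subset_iff.mpr (fiberPoint_mem_fiber M c)) ?_
  intro p hp
  have hlog : ∀ i, Real.log ‖p.2.2 i‖ = c.2 i := fun i =>
    congrFun (congrArg Prod.snd hp.2) i
  have hexp : ∀ i, (Real.exp (c.2 i) : ℂ) ≠ 0 := fun i => by
    exact_mod_cast (Real.exp_pos _).ne'
  have hnorm : ∀ k, ‖fiberPhases c p k‖ = 1 := by
    intro k
    refine Fin.addCases (fun j => ?_) (fun i => ?_) k
    · simp only [fiberPhases, Fin.addCases_left]
      exact norm_majorPhase (norm_sq_sub_of_mem_fiber hp j) (hc.ne_zero_of_mem_fiber hp j)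
    · simp only [fiberPhases, Fin.addCases_right]
      rw [← hlog, Real.exp_log (norm_pos_iff.mpr (hp.1.1 i)), norm_div, Complex.norm_real,
        norm_norm, div_self (norm_ne_zero_iff.mpr (hp.1.1 i))]
  -- The preimage of `p` is its tuple of phases, from which `hyperbolaPoint_majorPhase` recovers
  -- each pair $(x_j,y_j)$.
  let t : Torus (n + m) := fun k => ⟨fiberPhases c p k, mem_sphere_zero_iff_norm.mpr (hnorm k)⟩
  have ht : torusCoe t = fiberPhases c p := rfl
  have hz : polarCoords c (torusCoe t) = p.2.2 := by
    funext i
    simp only [polarCoords, ht, fiberPhases, Fin.addCases_right]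
    exact mul_div_cancel₀ _ (hexp i)
  have hpair : ∀ j, hyperbolaPoint (c.1 j)
      ((∏ i, polarCoords c (torusCoe t) i ^ M i j) + 1) (torusCoe t (Fin.castAdd m j))
      = (p.1 j, p.2.1 j) := by
    intro j
    rw [hz, ← mul_eq_of_mem_totalSpace hp.1 j, ht]
    simp only [fiberPhases, Fin.addCases_left]
    exact hyperbolaPoint_majorPhase (norm_sq_sub_of_mem_fiber hp j)
      (hc.ne_zero_of_mem_fiber hp j)
  exact ⟨t, Prod.ext (funext fun j => congrArg Prod.fst (hpair j))
    (Prod.ext (funext fun j => congrArg Prod.snd (hpair j)) hz)⟩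

theorem IsNondegenerate.isEmbeddedTorus_fiber {M : Matrix (Fin m) (Fin n) ℤ} {c : Base m n}
    (hc : IsNondegenerate M c) : IsEmbeddedTorus (n + m) (fiber M c) := by
  rw [← range_fiberPoint hc]
  exact isEmbeddedTorus_of_leftInverse (fiberPoint M c) (fiberPhases c)
    (contDiffAt_fiberPoint hc)
    (fun t => differentiableAt_fiberPhases hc (fiberPoint_mem_fiber M c t))
    (fiberPhases_fiberPoint hc)

end FiberParametrization

end IsolatedCluster

theorem corollary3p9 {m n : ℕ} (hmn : n ≤ m) (M : Matrix (Fin m) (Fin n) ℤ)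
    (hM : (M.map (Int.cast : ℤ → ℚ)).rank = min m n) :
    IsOpen {c : IsolatedCluster.Base m n | IsolatedCluster.IsRegularValue M c} ∧
    Dense {c : IsolatedCluster.Base m n | IsolatedCluster.IsRegularValue M c} ∧
    ∀ c : IsolatedCluster.Base m n, IsolatedCluster.IsRegularValue M c →
      IsolatedCluster.IsEmbeddedTorus (n + m) (IsolatedCluster.fiber M c) := by
  rw [min_eq_right hmn] at hM
  simp only [IsolatedCluster.isRegularValue_iff hM]
  exact ⟨IsolatedCluster.isOpen_isNondegenerate M, IsolatedCluster.dense_isNondegenerate M,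
    fun c hc => hc.isEmbeddedTorus_fiber⟩
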